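/- Let $d\ge 0$. For a sequence $\mathbf A=(a_1,\dots,a_n)$ of (not necessarily distinct) points of $\mathbb R^d$, the sweep polytope of $\mathbf A$ is the zonotope $$S(\mathbf A)=\sum_{1\le i<j\le n}\Big[-\tfrac{a_i-a_j}{2},\tfrac{a_i-a_j}{2}\Big]$$ (a point if $n\le 1$). For a polytope $P$ and a linear functional $\pi$ with image $Q=\pi(P)\subset\mathbb R$, the monotone path polytope is the normalized Minkowski integral $$\Sigma(P,\pi)=\frac1{\operatorname{vol}(Q)}\int_{Q}\big(P\cap\pi^{-1}(y)\big)\,dy=\Big\{\tfrac1{\operatorname{vol}(Q)}\int_Q\gamma(y)\,dy \;:\; \gamma:Q\to P \text{ integrable},\ \pi\circ\gamma=\mathrm{id}_Q\Big\},$$ where length is used if $Q$ is a segment, and $\Sigma(P,\pi)=P$ if $Q$ is a point. Two polytopes are normally equivalent if they have the same normal fan. 1. Let $Z=c+\sum_{i=1}^m[-z_i,z_i]\subset\mathbb R^d$ be a zonotope, $\pi:\mathbb R^d\to\mathbb R$ a linear functional, $Z^\pi$ the face of $Z$ on which $\pi$ is minimal, and $\mathbf A$ the configuration of the points $\frac{1}{\pi(z_i)}z_i$,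 for those $i$ with $\pi(z_i)\ne0$. Then $\Sigma(Z,\pi)$ is a polytope that is normally equivalent to the Minkowski sum $Z^\pi+S(\mathbf A)$. 2. In particular, if $\pi(z_i)\neq 0$ for every nonzero generator $z_i$, then $\Sigma(Z,\pi)$ is normally equivalent to the sweep polytope $S(\mathbf A)$. 3. Conversely, let $\mathbf A=(a_1,\dots,a_n)$ be any sequence of points in $\mathbb R^d$, let $Z(\hat{\mathbf A})=\sum_{i=1}^n[-\hat a_i,\hat a_i]\subset\mathbb R^{d}\times\mathbb R$ with $\hat a_i=(a_i,1)$, and let $h$ be the last coordinate on $\mathbb R^d\times\mathbb R$. Then $\Sigma\big(\tfrac n2 Z(\hat{\mathbf A}),h\big)=S(\mathbf A)\times\{0\}$, and $S(\mathbf A)$ is affinely isomorphic to $\Sigma(Z(\hat{\mathbf A}),h)$. -/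

import Mathlib

open MeasureTheory
open scoped Pointwise

noncomputable section

/-- A (convex) polytope: the convex hull of finitely many points. -/
def IsPolytope {E : Type*} [AddCommGroup E] [Module ℝ E] (P : Set E) : Prop :=
  ∃ S : Set E, S.Finite ∧ P = convexHull ℝ S

/-- The zonotope with centre `c` and generators `z i`: the Minkowski sum
`c + ∑ i, [-z i, z i]`. -/
def zonotope {E ι : Type*} [AddCommGroup E] [Module ℝ E] [Fintype ι] (c : E) (z : ι → E) :
    Set E :=
  {c} + ∑ i, segment ℝ (-z i) (z i)

/-- The sweep polytope of a configuration of points indexed by a finite linearly ordered set: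
the Minkowski sum of the segments `[-(a i - a j) / 2, (a i - a j) / 2]` over all `i < j`. -/
def sweepPolytope {E ι : Type*} [AddCommGroup E] [Module ℝ E] [Fintype ι] [LinearOrder ι]
    (a : ι → E) : Set E :=
  ∑ p : ι × ι with p.1 < p.2,
    segment ℝ (-((1 / 2 : ℝ) • (a p.1 - a p.2))) ((1 / 2 : ℝ) • (a p.1 - a p.2))

/-- The face of `P` that minimizes the linear functional `π`. -/
def minFace {E : Type*} [AddCommGroup E] [Module ℝ E] (P : Set E) (π : E →ₗ[ℝ] ℝ) : Set E :=
  {x ∈ P | ∀ y ∈ P, π x ≤ π y}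

/-- The Minkowski (set-valued) integral `∫_Q S(y) dμ(y)`: the set of all integrals over `Q` of
integrable selections of the family `S`. -/
def minkowskiIntegral {E F : Type*} [NormedAddCommGroup E] [NormedSpace ℝ E]
    [MeasurableSpace F] (μ : Measure F) (Q : Set F) (S : F → Set E) : Set E :=
  {x | ∃ γ : F → E, IntegrableOn γ Q μ ∧ (∀ y ∈ Q, γ y ∈ S y) ∧ x = ∫ y in Q, γ y ∂μ}

/-- The dimension of (the affine hull of) a set. -/
def affineDim {F : Type*} [AddCommGroup F] [Module ℝ F] (Q : Set F) : ℕ :=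
  Module.finrank ℝ (vectorSpan ℝ Q)

/-- The fiber polytope of the projection `π : P → Q`, where `Q = π(P)`: the normalized Minkowski
integral of the fibers, `(1 / vol Q) ∫_Q (P ∩ π⁻¹(y)) dy`. The volume is that of dimension
`dim Q`, i.e. the Hausdorff measure of that dimension: Lebesgue measure if `Q` is a
segment in `ℝ`, and the counting measure if `Q` is a point (the fiber polytope is then `P`). -/
def fiberPolytope {E F : Type*} [NormedAddCommGroup E] [NormedSpace ℝ E]
    [NormedAddCommGroup F] [NormedSpace ℝ F] [MeasurableSpace F] [BorelSpace F]
    (P : Set E) (π : E →ₗ[ℝ] F) : Set E :=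
  ((Measure.hausdorffMeasure (affineDim (π '' P) : ℝ) : Measure F).real (π '' P))⁻¹ •
    minkowskiIntegral (Measure.hausdorffMeasure (affineDim (π '' P) : ℝ)) (π '' P)
      (fun y => P ∩ π ⁻¹' {y})

/-- The monotone path polytope of `P` and a linear functional `π`: the fiber polytope of
`π : P → π(P) ⊆ ℝ`. -/
def monotonePathPolytope {E : Type*} [NormedAddCommGroup E] [NormedSpace ℝ E]
    (P : Set E) (π : E →ₗ[ℝ] ℝ) : Set E :=
  fiberPolytope P π

/-- The normal cone of `P` at a face `F`: all `u` such that `⟨u, ·⟩` is maximized over `P` at every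
point of `F`. -/
def normalConeAt {E : Type*} [NormedAddCommGroup E] [InnerProductSpace ℝ E] (P F : Set E) :
    Set E :=
  {u | ∀ x ∈ F, ∀ y ∈ P, inner ℝ u y ≤ inner ℝ u x}

/-- The normal fan of a polytope `P`: the set of normal cones of its nonempty faces (the faces of a
polytope, `P` itself included, are its exposed subsets). -/
def normalFan {E : Type*} [NormedAddCommGroup E] [InnerProductSpace ℝ E] (P : Set E) :
    Set (Set E) :=
  {C | ∃ F : Set E, F.Nonempty ∧ IsExposed ℝ P F ∧ C = normalConeAt P F}

/-- Two sets are normally equivalent if they are polytopes with the same normal fan. -/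
def NormallyEquivalent {E : Type*} [NormedAddCommGroup E] [InnerProductSpace ℝ E]
    (P Q : Set E) : Prop :=
  IsPolytope P ∧ IsPolytope Q ∧ normalFan P = normalFan Q

/-- `P` and `Q` are affinely isomorphic: some affine map between the ambient spaces restricts to a
bijection from `P` onto `Q`. -/
def AffinelyIsomorphic {E F : Type*} [AddCommGroup E] [Module ℝ E] [AddCommGroup F] [Module ℝ F]
    (P : Set E) (Q : Set F) : Prop :=
  ∃ f : E →ᵃ[ℝ] F, Set.BijOn f P Q

/-- The homogenization `(a i, 1)` of a point configuration. The space `ℝ^(d+1)` is written as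
`ℝ^d × ℝ`; only its vector space structure and topology matter for fiber polytopes. -/
def homogenization {E ι : Type*} (a : ι → E) : ι → E × ℝ :=
  fun i => (a i, 1)

/-- The height: the last coordinate of a point of `ℝ^d × ℝ`. -/
def height (E : Type*) [AddCommGroup E] [Module ℝ E] : E × ℝ →ₗ[ℝ] ℝ :=
  LinearMap.snd ℝ E ℝ

end

/-! ### Zonotopes -/

/-! Every polytope in the statement is a zonotope, and a zonotope is determined by its support
function `f ↦ f c + ∑ i, |f (z i)|` (`mem_zonotope_iff_forall_le`), so the work is to compute the
support function of the monotone path polytope.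

Its value at `f` is the mean over `y` of the maximum of `f` on the fiber over `y`. Write a point of
`Z` as `c + ∑ s i • z i` and put `x i = s i * π (z i)`. Generators in the kernel of `π` contribute
`|f (z i)|` at best. The others pose a fractional knapsack problem: `|x i| ≤ |π (z i)|`, the sum of
the `x i` is prescribed by `y`, and `∑ x i * v i` is to be maximized, where `v i` is the value of
`f` at the point `z i / π (z i)` of the configuration. Filling in order of decreasing `v` is optimal
for all `y` at once (`sum_mul_le_sum_greedyFilling_mul`), and its integral is `∑ |π (z i)| |π (z j)|
|v i - v j|` over ordered pairs (`sum_integral_greedyFilling_mul`).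

Hence the monotone path polytope is the zonotope generated by the kernel generators and positive
multiples of differences of configuration points (`monotonePathPolytope_zonotope`). The former
generate the minimal face, the latter the sweep polytope, and positive rescaling of generators
preserves the normal fan (`normallyEquivalent_zonotope`). For a homogenized configuration all
heights agree, so the multiples are equal and explicit. -/

lemma abs_coe_sign_le_one (x : ℝ) : |(SignType.sign x : ℝ)| ≤ 1 := by
  rcases lt_trichotomy x 0 with h | h | h <;> simp [h]

lemma mem_segment_neg_self {E : Type*} [AddCommGroup E] [Module ℝ E] {z x : E} :
    x ∈ segment ℝ (-z) z ↔ ∃ s : ℝ, |s| ≤ 1 ∧ x = s • z := by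
  constructor
  · rintro ⟨a, b, ha, hb, hab, rfl⟩
    refine ⟨b - a, abs_le.2 ⟨by linarith, by linarith⟩, ?_⟩
    module
  · rintro ⟨s, hs, rfl⟩
    have := abs_le.1 hs
    refine ⟨(1 - s) / 2, (1 + s) / 2, by linarith, by linarith, by ring, ?_⟩
    module

lemma mem_zonotope {E ι : Type*} [AddCommGroup E] [Module ℝ E] [Fintype ι] {c : E} {z : ι → E}
    {x : E} : x ∈ zonotope c z ↔ ∃ s : ι → ℝ, (∀ i, |s i| ≤ 1) ∧ x = c + ∑ i, s i • z i := by
  simp only [zonotope, Set.singleton_add, Set.mem_image, Set.mem_fintype_sum, mem_segment_neg_self]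
  constructor
  · rintro ⟨y, ⟨g, hg, rfl⟩, rfl⟩
    choose s hs hgs using hg
    exact ⟨s, hs, by simp [hgs]⟩
  · rintro ⟨s, hs, rfl⟩
    exact ⟨_, ⟨fun i => s i • z i, fun i => ⟨s i, hs i, rfl⟩, rfl⟩, rfl⟩

lemma isPolytope_zonotope {E ι : Type*} [AddCommGroup E] [Module ℝ E] [Fintype ι] (c : E)
    (z : ι → E) : IsPolytope (zonotope c z) := by
  refine ⟨{c} + ∑ i, {-z i, z i}, ?_, ?_⟩
  · refine (Set.finite_singleton c).add ?_
    refine Finset.sum_induction _ Set.Finite (fun _ _ => Set.Finite.add) Set.finite_zero ?_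
    exact fun i _ => Set.toFinite _
  · simp only [zonotope, convexHull_add, convexHull_singleton, convexHull_sum, convexHull_pair]

lemma image_zonotope {E F ι : Type*} [AddCommGroup E] [Module ℝ E] [AddCommGroup F] [Module ℝ F]
    [Fintype ι] (f : E →ₗ[ℝ] F) (c : E) (z : ι → E) :
    f '' zonotope c z = zonotope (f c) (fun i => f (z i)) := by
  ext x
  simp only [Set.mem_image, mem_zonotope]
  constructor
  · rintro ⟨_, ⟨s, hs, rfl⟩, rfl⟩
    exact ⟨s, hs, by simp⟩
  · rintro ⟨s, hs, rfl⟩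
    exact ⟨_, ⟨s, hs, rfl⟩, by simp⟩

lemma convex_zonotope {E ι : Type*} [AddCommGroup E] [Module ℝ E] [Fintype ι] (c : E)
    (z : ι → E) : Convex ℝ (zonotope c z) := by
  obtain ⟨S, -, h⟩ := isPolytope_zonotope c z
  exact h ▸ convex_convexHull ℝ S

lemma le_of_mem_zonotope {E ι : Type*} [AddCommGroup E] [Module ℝ E] [Fintype ι] {c : E}
    {z : ι → E} {x : E} (hx : x ∈ zonotope c z) (f : E →ₗ[ℝ] ℝ) :
    f x ≤ f c + ∑ i, |f (z i)| := by
  obtain ⟨s, hs, rfl⟩ := mem_zonotope.1 hx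
  simp only [map_add, map_sum, map_smul, smul_eq_mul]
  gcongr with i
  calc s i * f (z i) ≤ |s i * f (z i)| := le_abs_self _
    _ = |s i| * |f (z i)| := abs_mul _ _
    _ ≤ 1 * |f (z i)| := by gcongr; exact hs i
    _ = _ := one_mul _

lemma exists_mem_zonotope_eq {E ι : Type*} [AddCommGroup E] [Module ℝ E] [Fintype ι] (c : E)
    (z : ι → E) (f : E →ₗ[ℝ] ℝ) : ∃ x ∈ zonotope c z, f x = f c + ∑ i, |f (z i)| := by
  refine ⟨c + ∑ i, (SignType.sign (f (z i)) : ℝ) • z i,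
    mem_zonotope.2 ⟨_, fun i => abs_coe_sign_le_one _, rfl⟩, ?_⟩
  simp [sign_mul_self]

/-- A zonotope is cut out by the inequalities given by its support function. -/
lemma mem_zonotope_iff_forall_le {E ι : Type*} [NormedAddCommGroup E] [NormedSpace ℝ E] [Fintype ι]
    {c : E} {z : ι → E} {x : E} :
    x ∈ zonotope c z ↔ ∀ f : E →L[ℝ] ℝ, f x ≤ f c + ∑ i, |f (z i)| := by
  refine ⟨fun hx f => le_of_mem_zonotope hx (f : E →ₗ[ℝ] ℝ), fun h => ?_⟩
  by_contra hx
  obtain ⟨S, hS, hZ⟩ := isPolytope_zonotope c z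
  have hcl : IsClosed (zonotope c z) := hZ ▸ (hS.isClosed_convexHull ℝ)
  obtain ⟨f, u, hu, hfx⟩ := geometric_hahn_banach_closed_point (convex_zonotope c z) hcl hx
  obtain ⟨y, hy, hfy⟩ := exists_mem_zonotope_eq c z (f : E →ₗ[ℝ] ℝ)
  have h1 := hu y hy
  have h2 := h f
  simp only [ContinuousLinearMap.coe_coe] at hfy
  linarith

/-- This compares generating families with different index types, where zero, repeated or negated
generators are immaterial. -/
lemma zonotope_eq_of_support_eq {E ι κ : Type*} [NormedAddCommGroup E] [NormedSpace ℝ E]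
    [Fintype ι] [Fintype κ] {c c' : E} {z : ι → E} {w : κ → E}
    (h : ∀ f : E →L[ℝ] ℝ, f c + ∑ i, |f (z i)| = f c' + ∑ k, |f (w k)|) :
    zonotope c z = zonotope c' w := by
  ext x
  simp only [mem_zonotope_iff_forall_le, h]

lemma zonotope_add_zonotope {E ι κ : Type*} [AddCommGroup E] [Module ℝ E]
    [Fintype ι] [Fintype κ] (c c' : E) (z : ι → E) (w : κ → E) :
    zonotope c z + zonotope c' w = zonotope (c + c') (Sum.elim z w) := by
  simp only [zonotope, Fintype.sum_sum_type, Sum.elim_inl, Sum.elim_inr,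
    ← Set.singleton_add_singleton]
  abel

lemma smul_zonotope {E ι : Type*} [AddCommGroup E] [Module ℝ E] [Fintype ι] (r : ℝ) (c : E)
    (z : ι → E) : r • zonotope c z = zonotope (r • c) (fun i => r • z i) :=
  image_zonotope (LinearMap.lsmul ℝ E r) c z

lemma prod_singleton_zero_zonotope {E ι : Type*} [AddCommGroup E] [Module ℝ E] [Fintype ι]
    (z : ι → E) :
    zonotope 0 z ×ˢ ({0} : Set ℝ) = zonotope (0 : E × ℝ) (fun i => (z i, (0 : ℝ))) := by
  have h := image_zonotope (LinearMap.inl ℝ E ℝ) 0 z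
  simp only [map_zero, LinearMap.inl_apply] at h
  rw [← h]
  ext ⟨x, y⟩
  simp [eq_comm]

/-- The faces of a zonotope that minimize a functional are zonotopes. -/
lemma minFace_zonotope {E ι : Type*} [AddCommGroup E] [Module ℝ E] [Fintype ι] (c : E)
    (z : ι → E) (π : E →ₗ[ℝ] ℝ) :
    minFace (zonotope c z) π =
      zonotope (c - ∑ i, (SignType.sign (π (z i)) : ℝ) • z i)
        (fun i => if π (z i) = 0 then z i else 0) := by
  classical
  ext x
  constructor
  · rintro ⟨hx, hmin⟩
    obtain ⟨s, hs, rfl⟩ := mem_zonotope.1 hx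
    obtain ⟨y, hy, hfy⟩ := exists_mem_zonotope_eq c z (-π)
    have h1 := hmin y hy
    simp only [LinearMap.neg_apply, abs_neg] at hfy
    simp only [map_add, map_sum, map_smul, smul_eq_mul] at h1
    have hle : ∀ i ∈ Finset.univ, 0 ≤ s i * π (z i) + |π (z i)| := fun i _ => by
      have : |s i * π (z i)| ≤ |π (z i)| := by
        rw [abs_mul]; exact mul_le_of_le_one_left (abs_nonneg _) (hs i)
      linarith [neg_abs_le (s i * π (z i))]
    have h0 : ∑ i, (s i * π (z i) + |π (z i)|) = 0 :=
      le_antisymm (by rw [Finset.sum_add_distrib]; linarith) (Finset.sum_nonneg hle)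
    have h2 := (Finset.sum_eq_zero_iff_of_nonneg hle).1 h0
    refine mem_zonotope.2 ⟨s, hs, ?_⟩
    rw [sub_add, ← Finset.sum_sub_distrib, sub_eq_add_neg, ← Finset.sum_neg_distrib]
    congr 1
    refine Finset.sum_congr rfl fun i hi => ?_
    have h3 := h2 i hi
    rcases lt_trichotomy (π (z i)) 0 with h | h | h
    · have : s i = 1 := by
        rw [abs_of_neg h] at h3; exact mul_right_cancel₀ h.ne (by linarith)
      simp [h, h.ne, this]
    · simp [h]
    · have : s i = -1 := by
        rw [abs_of_pos h] at h3; exact mul_right_cancel₀ h.ne' (by linarith)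
      simp [h, h.ne', this]
  · intro hx
    obtain ⟨s, hs, rfl⟩ := mem_zonotope.1 hx
    refine ⟨mem_zonotope.2 ⟨fun i => if π (z i) = 0 then s i else -(SignType.sign (π (z i)) : ℝ),
      fun i => ?_, ?_⟩, fun y hy => ?_⟩
    · by_cases h : π (z i) = 0 <;> simp [h, hs i, abs_coe_sign_le_one]
    · rw [sub_add, ← Finset.sum_sub_distrib, sub_eq_add_neg, ← Finset.sum_neg_distrib]
      congr 1
      refine Finset.sum_congr rfl fun i _ => ?_
      by_cases h : π (z i) = 0 <;> simp [h]
    · have := le_of_mem_zonotope hy (-π)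
      simp only [LinearMap.neg_apply, abs_neg] at this
      have h0 : ∀ i, s i * π (if π (z i) = 0 then z i else 0) = 0 := fun i => by
        by_cases h : π (z i) = 0 <;> simp [h]
      simp only [map_add, map_sub, map_sum, map_smul, smul_eq_mul, h0, sign_mul_self,
        Finset.sum_const_zero]
      linarith

/-- The normal fan of a zonotope only depends on the signs of the functionals on its generators. -/
lemma normalFan_zonotope {E ι : Type*} [NormedAddCommGroup E] [InnerProductSpace ℝ E] [Fintype ι]
    (c : E) (z : ι → E) :
    normalFan (zonotope c z) = Set.range fun l : E →L[ℝ] ℝ =>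
      {u | ∀ i, (0 < l (z i) → 0 ≤ inner ℝ u (z i)) ∧ (l (z i) < 0 → inner ℝ u (z i) ≤ 0) ∧
        (l (z i) = 0 → inner ℝ u (z i) = 0)} := by
  classical
  have hcone : ∀ l : E →L[ℝ] ℝ,
      normalConeAt (zonotope c z) {x ∈ zonotope c z | ∀ y ∈ zonotope c z, l y ≤ l x} =
      {u | ∀ i, (0 < l (z i) → 0 ≤ inner ℝ u (z i)) ∧ (l (z i) < 0 → inner ℝ u (z i) ≤ 0) ∧
        (l (z i) = 0 → inner ℝ u (z i) = 0)} := by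
    intro l
    have hface : ∀ s : ι → ℝ, (∀ i, |s i| ≤ 1) → (∀ i, s i * l (z i) = |l (z i)|) →
        c + ∑ i, s i • z i ∈ {x ∈ zonotope c z | ∀ y ∈ zonotope c z, l y ≤ l x} := by
      intro s hs hsl
      refine ⟨mem_zonotope.2 ⟨s, hs, rfl⟩, fun y hy => ?_⟩
      have := le_of_mem_zonotope hy (l : E →ₗ[ℝ] ℝ)
      simpa [hsl] using this
    ext u
    constructor
    · intro hu i
      -- A point of the `l`-maximal face whose free coefficients are chosen worst for `u`. If `u` is
      -- still maximal there, then `s i * ⟪u, z i⟫ = |⟪u, z i⟫|` for every `i`, which forces `⟪u, z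
      -- i⟫ = 0` where `l (z i) = 0`.
      set s : ι → ℝ := fun i => if l (z i) = 0 then -(SignType.sign (inner ℝ u (z i)) : ℝ)
        else (SignType.sign (l (z i)) : ℝ) with hsdef
      have hs : ∀ i, |s i| ≤ 1 := fun i => by
        by_cases h : l (z i) = 0 <;> simp [hsdef, h, abs_coe_sign_le_one]
      have hsl : ∀ i, s i * l (z i) = |l (z i)| := fun i => by
        by_cases h : l (z i) = 0 <;> simp [hsdef, h, sign_mul_self]
      obtain ⟨y, hy, hfy⟩ := exists_mem_zonotope_eq c z (innerSL ℝ u : E →ₗ[ℝ] ℝ)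
      have h1 := hu _ (hface s hs hsl) y hy
      simp only [ContinuousLinearMap.coe_coe, innerSL_apply_apply] at hfy
      rw [hfy, inner_add_right, inner_sum] at h1
      simp only [inner_smul_right] at h1
      have hle : ∀ i ∈ Finset.univ, 0 ≤ |inner ℝ u (z i)| - s i * inner ℝ u (z i) := fun i _ => by
        have : |s i * inner ℝ u (z i)| ≤ |inner ℝ u (z i)| := by
          rw [abs_mul]; exact mul_le_of_le_one_left (abs_nonneg _) (hs i)
        linarith [le_abs_self (s i * inner ℝ u (z i))]
      have h0 : ∑ i, (|inner ℝ u (z i)| - s i * inner ℝ u (z i)) = 0 :=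
        le_antisymm (by rw [Finset.sum_sub_distrib]; linarith) (Finset.sum_nonneg hle)
      have h2 := (Finset.sum_eq_zero_iff_of_nonneg hle).1 h0 i (Finset.mem_univ i)
      have h3 := abs_nonneg (inner ℝ u (z i))
      refine ⟨fun h => ?_, fun h => ?_, fun h => ?_⟩
      · simp only [hsdef, h, h.ne', sign_pos] at h2
        simp at h2
        linarith
      · simp only [hsdef, h, h.ne, sign_neg] at h2
        simp at h2
        linarith
      · simp only [hsdef, h, if_true, neg_mul, sign_mul_self] at h2
        exact abs_eq_zero.1 (by linarith)
    · rintro hu x ⟨hx, hmax⟩ y hy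
      obtain ⟨s, hs, rfl⟩ := mem_zonotope.1 hx
      obtain ⟨w, hw, hlw⟩ := exists_mem_zonotope_eq c z (l : E →ₗ[ℝ] ℝ)
      have h1 := hmax w hw
      simp only [ContinuousLinearMap.coe_coe] at hlw
      simp only [hlw, map_add, map_sum, map_smul, smul_eq_mul] at h1
      have hle : ∀ i ∈ Finset.univ, 0 ≤ |l (z i)| - s i * l (z i) := fun i _ => by
        have : |s i * l (z i)| ≤ |l (z i)| := by
          rw [abs_mul]; exact mul_le_of_le_one_left (abs_nonneg _) (hs i)
        linarith [le_abs_self (s i * l (z i))]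
      have h0 : ∑ i, (|l (z i)| - s i * l (z i)) = 0 :=
        le_antisymm (by rw [Finset.sum_sub_distrib]; linarith) (Finset.sum_nonneg hle)
      have h2 := (Finset.sum_eq_zero_iff_of_nonneg hle).1 h0
      have h3 : ∀ i, s i * inner ℝ u (z i) = |inner ℝ u (z i)| := fun i => by
        have h4 := h2 i (Finset.mem_univ i)
        rcases lt_trichotomy (l (z i)) 0 with h | h | h
        · have : s i = -1 := by
            rw [abs_of_neg h] at h4; exact mul_right_cancel₀ h.ne (by linarith)
          rw [this, abs_of_nonpos ((hu i).2.1 h)]; ring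
        · simp [(hu i).2.2 h]
        · have : s i = 1 := by
            rw [abs_of_pos h] at h4; exact mul_right_cancel₀ h.ne' (by linarith)
          rw [this, abs_of_nonneg ((hu i).1 h)]; ring
      have := le_of_mem_zonotope hy (innerSL ℝ u : E →ₗ[ℝ] ℝ)
      simp only [ContinuousLinearMap.coe_coe, innerSL_apply_apply] at this
      rw [inner_add_right, inner_sum]
      simpa only [inner_smul_right, h3] using this
  ext C
  constructor
  · rintro ⟨F, hF, hexp, rfl⟩
    obtain ⟨l, rfl⟩ := hexp hF
    exact ⟨l, (hcone l).symm⟩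
  · rintro ⟨l, rfl⟩
    obtain ⟨x, hx, hlx⟩ := exists_mem_zonotope_eq c z (l : E →ₗ[ℝ] ℝ)
    refine ⟨{x ∈ zonotope c z | ∀ y ∈ zonotope c z, l y ≤ l x}, ⟨x, hx, fun y hy => ?_⟩,
      fun _ => ⟨l, rfl⟩, (hcone l).symm⟩
    have := le_of_mem_zonotope hy (l : E →ₗ[ℝ] ℝ)
    rw [← hlx] at this
    exact this

/-- Rescaling the generators by positive factors and translating do not change the normal fan of a
zonotope. -/
lemma normallyEquivalent_zonotope {E ι : Type*} [NormedAddCommGroup E] [InnerProductSpace ℝ E]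
    [Fintype ι] (c c' : E) (z : ι → E) {r : ι → ℝ} (hr : ∀ i, 0 < r i) :
    NormallyEquivalent (zonotope c z) (zonotope c' (fun i => r i • z i)) := by
  refine ⟨isPolytope_zonotope _ _, isPolytope_zonotope _ _, ?_⟩
  rw [normalFan_zonotope, normalFan_zonotope]
  have hpos : ∀ i x, 0 < r i * x ↔ 0 < x := fun i x => mul_pos_iff_of_pos_left (hr i)
  have hneg : ∀ i x, r i * x < 0 ↔ x < 0 := fun i x => by
    rw [mul_neg_iff]; simp [hr i, (hr i).not_gt]
  have hle : ∀ i x, r i * x ≤ 0 ↔ x ≤ 0 := fun i x => by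
    rw [mul_nonpos_iff]; simp [(hr i).le, (hr i).not_ge]
  have hge : ∀ i x, 0 ≤ r i * x ↔ 0 ≤ x := fun i x => mul_nonneg_iff_of_pos_left (hr i)
  have hne : ∀ i, r i ≠ 0 := fun i => (hr i).ne'
  simp only [map_smul, inner_smul_right, smul_eq_mul, hpos, hneg, hle, hge, mul_eq_zero, hne,
    false_or]

/-- A sweep polytope as a zonotope whose generators are indexed by all ordered pairs. -/
lemma sweepPolytope_eq_zonotope {E ι : Type*} [NormedAddCommGroup E] [NormedSpace ℝ E] [Fintype ι]
    [LinearOrder ι] (a : ι → E) :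
    sweepPolytope a = zonotope 0 (fun p : ι × ι => (1 / 4 : ℝ) • (a p.1 - a p.2)) := by
  have h1 : sweepPolytope a = zonotope 0
      (fun p : {p : ι × ι // p.1 < p.2} => (1 / 2 : ℝ) • (a p.1.1 - a p.1.2)) := by
    rw [sweepPolytope, zonotope, Set.singleton_zero, zero_add]
    exact Finset.sum_subtype _ (by simp) _
  rw [h1]
  refine zonotope_eq_of_support_eq fun f => ?_
  congr 1
  have h2 := Finset.sum_subtype (Finset.univ.filter fun p : ι × ι => p.1 < p.2)
    (p := fun p => p.1 < p.2) (F := inferInstance) (by simp)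
    (fun p => |f ((1 / 2 : ℝ) • (a p.1 - a p.2))|)
  rw [← h2, Finset.sum_filter]
  -- Swapping the pair preserves the absolute value, so ordered pairs count each segment twice and
  -- `1 / 2` becomes `1 / 4`.
  have hsw : ∑ p : ι × ι, (if p.1 < p.2 then |f (a p.1 - a p.2)| else 0) =
      ∑ p : ι × ι, (if p.2 < p.1 then |f (a p.1 - a p.2)| else 0) := by
    rw [← (Equiv.prodComm ι ι).sum_comp]
    refine Finset.sum_congr rfl fun p _ => ?_
    simp only [Equiv.prodComm_apply, Prod.fst_swap, Prod.snd_swap]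
    rw [← neg_sub (a p.1), map_neg, abs_neg]
    congr
  have htot : ∑ p : ι × ι, |f (a p.1 - a p.2)| =
      ∑ p : ι × ι, (if p.1 < p.2 then |f (a p.1 - a p.2)| else 0) +
      ∑ p : ι × ι, (if p.2 < p.1 then |f (a p.1 - a p.2)| else 0) := by
    rw [← Finset.sum_add_distrib]
    refine Finset.sum_congr rfl fun p _ => ?_
    rcases lt_trichotomy p.1 p.2 with h | h | h
    · simp [h, h.not_gt]
    · simp [h]
    · simp [h, h.not_gt]
  simp only [map_smul, smul_eq_mul, abs_mul]
  rw [← Finset.mul_sum, htot, ← hsw, ← Finset.sum_add_distrib, Finset.mul_sum]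
  refine Finset.sum_congr rfl fun p _ => ?_
  split_ifs
  · rw [abs_of_pos (by norm_num : (0 : ℝ) < 1 / 2), abs_of_pos (by norm_num : (0 : ℝ) < 1 / 4)]
    ring
  · simp

/-! ### Greedy fillings -/

/-- The total length of the intervals that precede the `k`-th one, when intervals of lengths
`2 * t j` are put side by side from `0` on. -/
noncomputable def lengthBefore {ι : Type*} [Fintype ι] [LinearOrder ι] (t : ι → ℝ) (k : ι) : ℝ :=
  ∑ j with j < k, 2 * t j

/-- The greedy filling at time `τ`: all coordinates start at `-t k`, and one after the other they
grow with unit speed to `t k`. -/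
noncomputable def greedyFilling {ι : Type*} [Fintype ι] [LinearOrder ι] (t : ι → ℝ) (τ : ℝ)
    (k : ι) : ℝ :=
  min τ (lengthBefore t k + 2 * t k) - min τ (lengthBefore t k) - t k

section Greedy

variable {ι : Type*} [Fintype ι] [LinearOrder ι] {t : ι → ℝ}

lemma lengthBefore_nonneg (ht : ∀ k, 0 ≤ t k) (k : ι) : 0 ≤ lengthBefore t k :=
  Finset.sum_nonneg fun j _ => by linarith [ht j]

lemma lengthBefore_add_le (ht : ∀ k, 0 ≤ t k) (k : ι) :
    lengthBefore t k + 2 * t k ≤ 2 * ∑ j, t j := by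
  rw [lengthBefore, add_comm, ← Finset.sum_insert (f := fun j => 2 * t j) (by simp),
    Finset.mul_sum]
  exact Finset.sum_le_univ_sum_of_nonneg fun j => by linarith [ht j]

lemma lengthBefore_add_le_of_lt (ht : ∀ k, 0 ≤ t k) {i k : ι} (h : i < k) :
    lengthBefore t i + 2 * t i ≤ lengthBefore t k := by
  rw [lengthBefore, add_comm, ← Finset.sum_insert (f := fun j => 2 * t j) (by simp)]
  refine Finset.sum_le_sum_of_subset_of_nonneg (fun j hj => ?_) fun j _ _ => by linarith [ht j]
  simp only [Finset.mem_insert, Finset.mem_filter, Finset.mem_univ, true_and] at hj ⊢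
  rcases hj with rfl | hj
  exacts [h, hj.trans h]

/-- The differences of minima telescope, as each interval starts where its predecessor ends. The
induction adds the largest index last, which leaves the earlier intervals in place. -/
lemma sum_greedyFilling {τ : ℝ} (h0 : 0 ≤ τ) (h1 : τ ≤ 2 * ∑ j, t j) :
    ∑ k, greedyFilling t τ k = τ - ∑ j, t j := by
  have key : ∀ s : Finset ι, ∑ k ∈ s, (min τ ((∑ j ∈ s with j < k, 2 * t j) + 2 * t k) -
      min τ (∑ j ∈ s with j < k, 2 * t j)) = min τ (∑ j ∈ s, 2 * t j) - min τ 0 := by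
    intro s
    induction s using Finset.induction_on_max with
    | empty => simp
    | insert a s ha ih =>
      have has : a ∉ s := fun h => (ha a h).false
      have hfa : {j ∈ insert a s | j < a} = s := by
        ext j
        simp only [Finset.mem_filter, Finset.mem_insert]
        exact ⟨fun h => h.1.resolve_left h.2.ne, fun h => ⟨Or.inr h, ha j h⟩⟩
      have hfk : ∀ k ∈ s, {j ∈ insert a s | j < k} = {j ∈ s | j < k} := fun k hk => by
        rw [Finset.filter_insert, if_neg (ha k hk).not_gt]
      have hsum : ∑ k ∈ s, (min τ ((∑ j ∈ insert a s with j < k, 2 * t j) + 2 * t k) -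
          min τ (∑ j ∈ insert a s with j < k, 2 * t j)) = min τ (∑ j ∈ s, 2 * t j) - min τ 0 := by
        rw [← ih]
        exact Finset.sum_congr rfl fun k hk => by rw [hfk k hk]
      rw [Finset.sum_insert has, hfa, hsum, Finset.sum_insert has, add_comm (2 * t a)]
      ring
  have h := key Finset.univ
  rw [← Finset.mul_sum, min_eq_left h1, min_eq_right h0] at h
  simp only [greedyFilling, lengthBefore]
  rw [Finset.sum_sub_distrib, h, sub_zero]

lemma abs_greedyFilling_le (ht : ∀ k, 0 ≤ t k) (τ : ℝ) (k : ι) :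
    |greedyFilling t τ k| ≤ t k := by
  have := ht k
  rw [greedyFilling, abs_le]
  rcases min_cases τ (lengthBefore t k + 2 * t k) with h | h <;>
  rcases min_cases τ (lengthBefore t k) with h' | h' <;> constructor <;> linarith

/-- The greedy filling maximizes functionals with decreasing coefficients. -/
lemma sum_mul_le_sum_greedyFilling_mul (ht : ∀ k, 0 ≤ t k) {v s : ι → ℝ} (hv : Antitone v)
    {τ : ℝ} (h0 : 0 ≤ τ) (hs : ∀ k, |s k| ≤ t k)
    (hsum : ∑ k, s k = ∑ k, greedyFilling t τ k) :
    ∑ k, s k * v k ≤ ∑ k, greedyFilling t τ k * v k := by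
  rcases isEmpty_or_nonempty ι with hι | hι
  · simp
  -- Let `k₀` be the last interval begun by time `τ`: those before it are full, those after it
  -- empty. Since both sums of coefficients agree, `v k₀` may be subtracted from `v`, and the
  -- inequality then holds term by term.
  have hne : (Finset.univ.filter fun k => lengthBefore t k ≤ τ).Nonempty := by
    refine ⟨Finset.univ.min' Finset.univ_nonempty, ?_⟩
    have : lengthBefore t (Finset.univ.min' Finset.univ_nonempty) = 0 := by
      rw [lengthBefore, Finset.filter_false_of_mem, Finset.sum_empty]
      exact fun j _ => (Finset.min'_le _ j (Finset.mem_univ j)).not_gt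
    simp [this, h0]
  obtain ⟨k₀, hk₀, hmax⟩ := Finset.exists_max_image _ id hne
  simp only [Finset.mem_filter, Finset.mem_univ, true_and, id] at hk₀ hmax
  have hterm : ∀ k, s k * (v k - v k₀) ≤ greedyFilling t τ k * (v k - v k₀) := by
    intro k
    have hsk := abs_le.1 (hs k)
    rcases lt_trichotomy k k₀ with h | rfl | h
    · have h1 := lengthBefore_add_le_of_lt ht h
      have h2 := ht k
      have hg : greedyFilling t τ k = t k := by
        rw [greedyFilling, min_eq_right (by linarith), min_eq_right (by linarith)]; ring
      rw [hg]
      exact mul_le_mul_of_nonneg_right hsk.2 (sub_nonneg.2 (hv h.le))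
    · simp
    · have h1 : τ < lengthBefore t k := not_le.1 fun h' => (hmax k h').not_gt h
      have h2 := ht k
      have hg : greedyFilling t τ k = -t k := by
        rw [greedyFilling, min_eq_left (by linarith), min_eq_left (by linarith)]; ring
      rw [hg]
      exact mul_le_mul_of_nonpos_right hsk.1 (sub_nonpos.2 (hv h.le))
  have hall := Finset.sum_le_sum fun k (_ : k ∈ Finset.univ) => hterm k
  simp only [mul_sub, Finset.sum_sub_distrib, ← Finset.sum_mul, hsum] at hall
  linarith

lemma continuous_greedyFilling (k : ι) : Continuous fun τ => greedyFilling t τ k := by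
  unfold greedyFilling
  fun_prop

lemma integral_min_const {b L : ℝ} (h0 : 0 ≤ b) (h1 : b ≤ L) :
    ∫ τ in (0 : ℝ)..L, min τ b = L * b - b ^ 2 / 2 := by
  have hc : Continuous fun τ : ℝ => min τ b := by fun_prop
  rw [← intervalIntegral.integral_add_adjacent_intervals (hc.intervalIntegrable 0 b)
    (hc.intervalIntegrable b L)]
  have e1 : ∫ τ in (0 : ℝ)..b, min τ b = ∫ τ in (0 : ℝ)..b, τ :=
    intervalIntegral.integral_congr fun x hx => by
      rw [Set.uIcc_of_le h0] at hx
      exact min_eq_left hx.2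
  have e2 : ∫ τ in b..L, min τ b = ∫ _ in b..L, b :=
    intervalIntegral.integral_congr fun x hx => by
      rw [Set.uIcc_of_le h1] at hx
      exact min_eq_right hx.1
  rw [e1, e2, integral_id, intervalIntegral.integral_const, smul_eq_mul]
  ring

lemma integral_greedyFilling (ht : ∀ k, 0 ≤ t k) (k : ι) :
    ∫ τ in (0 : ℝ)..2 * ∑ j, t j, greedyFilling t τ k =
      2 * t k * (∑ j, t j - lengthBefore t k - t k) := by
  have h1 := lengthBefore_nonneg ht k
  have h2 := lengthBefore_add_le ht k
  have h3 := ht k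
  have hc : ∀ b : ℝ, IntervalIntegrable (fun τ : ℝ => min τ b) volume 0 (2 * ∑ j, t j) :=
    fun b => Continuous.intervalIntegrable (by fun_prop) _ _
  simp only [greedyFilling]
  rw [intervalIntegral.integral_sub ((hc _).sub (hc _)) intervalIntegrable_const,
    intervalIntegral.integral_sub (hc _) (hc _), integral_min_const (by linarith) h2,
    integral_min_const h1 (by linarith), intervalIntegral.integral_const, smul_eq_mul]
  ring

/-- The integral of the greedy filling, evaluated at a functional with decreasing coefficients. -/
lemma sum_integral_greedyFilling_mul (ht : ∀ k, 0 ≤ t k) {v : ι → ℝ} (hv : Antitone v) :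
    ∑ k, (∫ τ in (0 : ℝ)..2 * ∑ j, t j, greedyFilling t τ k) * v k =
      ∑ k, ∑ j, t k * t j * |v k - v j| := by
  -- The antisymmetric sign of the order; as `v` is antitone, it removes the absolute values.
  set e : ι → ι → ℝ := fun k j => if k < j then 1 else if j < k then -1 else 0 with he
  have hanti : ∀ k j, e j k = -e k j := fun k j => by
    rcases lt_trichotomy k j with h | rfl | h
    · simp [he, h, h.not_gt]
    · simp [he]
    · simp [he, h, h.not_gt]
  have habs : ∀ k j, |v k - v j| = e k j * (v k - v j) := fun k j => by
    rcases lt_trichotomy k j with h | rfl | h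
    · simp [he, h, abs_of_nonneg (sub_nonneg.2 (hv h.le))]
    · simp
    · simp [he, h, h.not_gt, abs_of_nonpos (sub_nonpos.2 (hv h.le))]
  have hint : ∀ k, 2 * t k * (∑ j, t j - lengthBefore t k - t k) =
      2 * ∑ j, t k * t j * e k j := fun k => by
    -- `lengthBefore` counts each earlier `t j` twice, so what remains is the later `t j` minus the
    -- earlier ones.
    have h1 : ∑ j, t j - lengthBefore t k - t k = ∑ j, t j * e k j := by
      have h2 : t k = ∑ j, if j = k then t j else 0 := by simp
      conv_lhs => arg 2; rw [h2]
      rw [lengthBefore, Finset.sum_filter, ← Finset.sum_sub_distrib, ← Finset.sum_sub_distrib]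
      refine Finset.sum_congr rfl fun j _ => ?_
      rcases lt_trichotomy k j with h | rfl | h
      · simp [he, h, h.not_gt, h.ne']
      · simp [he]
      · simp [he, h, h.not_gt, h.ne]; ring
    rw [h1, Finset.mul_sum, Finset.mul_sum]
    exact Finset.sum_congr rfl fun j _ => by ring
  have hswap : ∑ k, ∑ j, t k * t j * e k j * v j = -∑ k, ∑ j, t k * t j * e k j * v k := by
    rw [Finset.sum_comm, ← Finset.sum_neg_distrib]
    refine Finset.sum_congr rfl fun k _ => ?_
    rw [← Finset.sum_neg_distrib]
    exact Finset.sum_congr rfl fun j _ => by rw [hanti k j]; ring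
  have hR : ∑ k, ∑ j, t k * t j * |v k - v j| =
      ∑ k, ∑ j, t k * t j * e k j * v k - ∑ k, ∑ j, t k * t j * e k j * v j := by
    simp only [← Finset.sum_sub_distrib]
    exact Finset.sum_congr rfl fun k _ => Finset.sum_congr rfl fun j _ => by rw [habs]; ring
  rw [hR, hswap, sub_neg_eq_add, ← two_mul]
  simp only [integral_greedyFilling ht, hint, mul_assoc, ← Finset.mul_sum, Finset.sum_mul]

end Greedy

/-! ### Monotone path polytopes of zonotopes -/

lemma convex_minkowskiIntegral {E F : Type*} [NormedAddCommGroup E] [NormedSpace ℝ E]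
    [MeasurableSpace F] (μ : Measure F) {Q : Set F} {S : F → Set E}
    (hS : ∀ y ∈ Q, Convex ℝ (S y)) : Convex ℝ (minkowskiIntegral μ Q S) := by
  rintro _ ⟨γ, hγ, hγS, rfl⟩ _ ⟨δ, hδ, hδS, rfl⟩ a b ha hb hab
  refine ⟨fun y => a • γ y + b • δ y, (hγ.smul a).add (hδ.smul b),
    fun y hy => hS y hy (hγS y hy) (hδS y hy) ha hb hab, ?_⟩
  exact ((integral_add (hγ.smul a) (hδ.smul b)).trans
    (congrArg₂ _ (integral_smul a γ) (integral_smul b δ))).symm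

lemma affineDim_Icc {a b : ℝ} (hab : a < b) : affineDim (Set.Icc a b) = 1 := by
  have h : affineSpan ℝ (Set.Icc a b) = ⊤ :=
    affineSpan_eq_top_of_nonempty_interior (by
      rw [(convex_Icc a b).convexHull_eq, interior_Icc]; exact Set.nonempty_Ioo.2 hab)
  rw [affineDim, ← direction_affineSpan, h, AffineSubspace.direction_top, finrank_top,
    Module.finrank_self]

lemma monotonePathPolytope_of_image_eq_Icc {E : Type*} [NormedAddCommGroup E] [NormedSpace ℝ E]
    {P : Set E} {π : E →ₗ[ℝ] ℝ} {a b : ℝ} (hab : a < b) (h : π '' P = Set.Icc a b) :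
    monotonePathPolytope P π =
      (b - a)⁻¹ • minkowskiIntegral volume (Set.Icc a b) (fun y => P ∩ π ⁻¹' {y}) := by
  rw [monotonePathPolytope, fiberPolytope, h, affineDim_Icc hab, Nat.cast_one,
    hausdorffMeasure_real, Real.volume_real_Icc_of_le hab.le]

/-- If the functional is constant on `P`, then the monotone path polytope is `P` itself. -/
lemma monotonePathPolytope_of_image_eq_singleton {E : Type*} [NormedAddCommGroup E]
    [NormedSpace ℝ E] [CompleteSpace E] {P : Set E} {π : E →ₗ[ℝ] ℝ} {q : ℝ} (h : π '' P = {q}) :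
    monotonePathPolytope P π = P := by
  have hdim : affineDim ({q} : Set ℝ) = 0 := by
    rw [affineDim, vectorSpan_singleton, finrank_bot]
  have hint : ∀ γ : ℝ → E, ∫ y in ({q} : Set ℝ), γ y ∂(Measure.hausdorffMeasure 0) = γ q := by
    intro γ
    rw [Measure.restrict_singleton, Measure.hausdorffMeasure_zero_singleton, one_smul,
      integral_dirac]
  rw [monotonePathPolytope, fiberPolytope, h, hdim, Nat.cast_zero, measureReal_def,
    Measure.hausdorffMeasure_zero_singleton, ENNReal.toReal_one, inv_one, one_smul]
  ext x
  constructor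
  · rintro ⟨γ, -, hγ, rfl⟩
    rw [hint]
    exact (hγ q rfl).1
  · intro hx
    have hq : π x = q := by
      have : π x ∈ π '' P := ⟨x, hx, rfl⟩
      rwa [h] at this
    refine ⟨fun _ => x, ?_, fun y hy => ⟨hx, ?_⟩, (hint fun _ => x).symm⟩
    · refine integrableOn_const ?_
      rw [Measure.hausdorffMeasure_zero_singleton]
      exact ENNReal.one_ne_top
    · rw [Set.mem_singleton_iff.1 hy]
      exact hq

lemma zonotope_real {ι : Type*} [Fintype ι] (c : ℝ) (t : ι → ℝ) :
    zonotope c t = Set.Icc (c - ∑ i, |t i|) (c + ∑ i, |t i|) := by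
  ext x
  constructor
  · intro hx
    have h1 := le_of_mem_zonotope hx LinearMap.id
    have h2 := le_of_mem_zonotope hx (-LinearMap.id)
    simp only [LinearMap.neg_apply, LinearMap.id_apply, abs_neg] at h1 h2
    exact ⟨by linarith, h1⟩
  · intro hx
    refine mem_zonotope_iff_forall_le.2 fun f => ?_
    have hf : ∀ y, f y = y * f 1 := fun y => by rw [← smul_eq_mul, ← map_smul, smul_eq_mul, mul_one]
    have hfi : ∀ i, |f (t i)| = |t i| * |f 1| := fun i => by rw [hf, abs_mul]
    have hxc : |x - c| ≤ ∑ i, |t i| := abs_le.2 ⟨by linarith [hx.1], by linarith [hx.2]⟩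
    have h1 : (x - c) * f 1 ≤ (∑ i, |t i|) * |f 1| :=
      (le_abs_self _).trans (by rw [abs_mul]; gcongr)
    simp only [hfi, ← Finset.sum_mul]
    rw [hf x, hf c]
    linarith

lemma image_zonotope_eq_Icc {E ι : Type*} [AddCommGroup E] [Module ℝ E] [Fintype ι] (c : E)
    (z : ι → E) (π : E →ₗ[ℝ] ℝ) :
    π '' zonotope c z = Set.Icc (π c - ∑ i, |π (z i)|) (π c + ∑ i, |π (z i)|) := by
  rw [image_zonotope, zonotope_real]

/-! ### Greedy sections and the support function of the monotone path polytope -/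

/-- The generators of the monotone path polytope of a zonotope with generators `z`: the generators
of the fibers, and scaled differences of the points `(1 / π (z i)) • z i`. -/
noncomputable def monotonePathGenerators {E ι : Type*} [AddCommGroup E] [Module ℝ E] [Fintype ι]
    (z : ι → E) (π : E →ₗ[ℝ] ℝ) : ι ⊕ ι × ι → E :=
  Sum.elim (fun i => if π (z i) = 0 then z i else 0)
    (fun p => (|π (z p.1)| * |π (z p.2)| / (2 * ∑ i, |π (z i)|)) •
      ((1 / π (z p.1)) • z p.1 - (1 / π (z p.2)) • z p.2))

section Section

variable {E : Type*} [NormedAddCommGroup E] [NormedSpace ℝ E] {m : ℕ}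

/-- The coefficients of the greedy section that fills the generators in the order given by `σ`. -/
noncomputable def greedyCoeff (c : E) (z : Fin m → E) (π : E →ₗ[ℝ] ℝ) (ε : Fin m → SignType)
    (σ : Equiv.Perm (Fin m)) (y : ℝ) (i : Fin m) : ℝ :=
  if π (z i) = 0 then (ε i : ℝ) else
    greedyFilling (fun k => |π (z (σ k))|) (y - (π c - ∑ i, |π (z i)|)) (σ.symm i) / π (z i)

/-- The greedy section of `π` over the image of a zonotope. -/
noncomputable def greedySection (c : E) (z : Fin m → E) (π : E →ₗ[ℝ] ℝ) (ε : Fin m → SignType)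
    (σ : Equiv.Perm (Fin m)) (y : ℝ) : E :=
  c + ∑ i, greedyCoeff c z π ε σ y i • z i

variable (c : E) (z : Fin m → E) (π : E →ₗ[ℝ] ℝ) (ε : Fin m → SignType)
  (σ : Equiv.Perm (Fin m))

lemma continuous_greedySection : Continuous (greedySection c z π ε σ) := by
  unfold greedySection
  refine continuous_const.add (continuous_finsetSum _ fun i _ => Continuous.smul ?_ continuous_const)
  unfold greedyCoeff
  split_ifs
  · exact continuous_const
  · exact ((continuous_greedyFilling _).comp (continuous_id.sub continuous_const)).div_const _

/-- Reindexing by `σ` separates the constant contribution of the kernel generators from the knapsack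
objective. -/
lemma apply_greedySection (f : E →ₗ[ℝ] ℝ) (y : ℝ) :
    f (greedySection c z π ε σ y) = f c + ∑ i, (if π (z i) = 0 then (ε i : ℝ) * f (z i) else 0) +
      ∑ k, greedyFilling (fun k => |π (z (σ k))|) (y - (π c - ∑ i, |π (z i)|)) k *
        f ((1 / π (z (σ k))) • z (σ k)) := by
  rw [← Equiv.sum_comp σ.symm fun k =>
    greedyFilling (fun k => |π (z (σ k))|) (y - (π c - ∑ i, |π (z i)|)) k *
      f ((1 / π (z (σ k))) • z (σ k))]
  simp only [Equiv.apply_symm_apply, greedySection, map_add, map_sum, map_smul, smul_eq_mul]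
  rw [add_assoc, ← Finset.sum_add_distrib]
  congr 1
  refine Finset.sum_congr rfl fun i _ => ?_
  unfold greedyCoeff
  split_ifs with h
  · simp [h]
  · ring

lemma greedySection_mem {y : ℝ}
    (hy : y ∈ Set.Icc (π c - ∑ i, |π (z i)|) (π c + ∑ i, |π (z i)|)) :
    greedySection c z π ε σ y ∈ zonotope c z ∩ π ⁻¹' {y} := by
  constructor
  · refine mem_zonotope.2 ⟨_, fun i => ?_, rfl⟩
    unfold greedyCoeff
    split_ifs with h
    · cases ε i <;> simp
    · rw [abs_div, div_le_one (abs_pos.2 h)]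
      simpa using abs_greedyFilling_le (t := fun k => |π (z (σ k))|) (fun _ => abs_nonneg _)
        (y - (π c - ∑ i, |π (z i)|)) (σ.symm i)
  · have hT : ∑ k, |π (z (σ k))| = ∑ i, |π (z i)| := Equiv.sum_comp σ fun i => |π (z i)|
    have h0 : ∀ i, (if π (z i) = 0 then (ε i : ℝ) * π (z i) else 0) = 0 := fun i => by
      split_ifs with h <;> simp [h]
    have h1 : ∀ k, greedyFilling (fun k => |π (z (σ k))|) (y - (π c - ∑ i, |π (z i)|)) k *
        π ((1 / π (z (σ k))) • z (σ k)) =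
        -- A kernel generator has an interval of length zero, so its filling vanishes and the
        -- default value of `1 / 0` does no harm.
        greedyFilling (fun k => |π (z (σ k))|) (y - (π c - ∑ i, |π (z i)|)) k := fun k => by
      by_cases h : π (z (σ k)) = 0
      · have := abs_greedyFilling_le (t := fun k => |π (z (σ k))|) (fun _ => abs_nonneg _)
          (y - (π c - ∑ i, |π (z i)|)) k
        simp only [h, abs_zero] at this
        rw [abs_nonpos_iff.1 this, zero_mul]
      · simp [h]
    rw [Set.mem_preimage, Set.mem_singleton_iff, apply_greedySection]
    simp only [h0, h1, Finset.sum_const_zero]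
    rw [sum_greedyFilling (by linarith [hy.1]) (by rw [hT]; linarith [hy.2]), hT]
    ring

variable {c z π}

/-- For every functional, some greedy section maximizes it over all fibers, and the mean value of
the functional along that section is the support function of the zonotope generated by
`monotonePathGenerators`. -/
lemma exists_greedySection_maximal (hT : 0 < ∑ i, |π (z i)|) (f : E →L[ℝ] ℝ) :
    ∃ (ε : Fin m → SignType) (σ : Equiv.Perm (Fin m)),
      (∀ y, ∀ x ∈ zonotope c z ∩ π ⁻¹' {y}, f x ≤ f (greedySection c z π ε σ y)) ∧
      (2 * ∑ i, |π (z i)|)⁻¹ * ∫ y in Set.Icc (π c - ∑ i, |π (z i)|) (π c + ∑ i, |π (z i)|),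
        f (greedySection c z π ε σ y) = f c + ∑ k, |f (monotonePathGenerators z π k)| := by
  set T := ∑ i, |π (z i)| with hTdef
  set v : Fin m → ℝ := fun i => f ((1 / π (z i)) • z i) with hvdef
  -- Sorting `-v` increasingly lists `v` in decreasing order. This order does not depend on `y`, so
  -- one section serves all fibers.
  set σ : Equiv.Perm (Fin m) := Tuple.sort fun i => -v i with hσ
  have hv : Antitone fun k => v (σ k) := fun i j hij =>
    neg_le_neg_iff.1 (Tuple.monotone_sort (fun i => -v i) hij)
  have ht : ∀ k, 0 ≤ |π (z (σ k))| := fun _ => abs_nonneg _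
  have hTσ : ∑ k, |π (z (σ k))| = T := Equiv.sum_comp σ fun i => |π (z i)|
  have happ := apply_greedySection c z π (fun i => SignType.sign (f (z i))) σ (f : E →ₗ[ℝ] ℝ)
  simp only [ContinuousLinearMap.coe_coe, sign_mul_self] at happ
  refine ⟨fun i => SignType.sign (f (z i)), σ, ?_, ?_⟩
  · rintro y x ⟨hx, hxy⟩
    have hy : y ∈ Set.Icc (π c - T) (π c + T) := by
      rw [← image_zonotope_eq_Icc]
      exact ⟨x, hx, hxy⟩
    obtain ⟨s, hs, rfl⟩ := mem_zonotope.1 hx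
    rw [happ]
    have hsz : ∑ i, s i * π (z i) = y - π c := by
      have : π (c + ∑ i, s i • z i) = y := hxy
      simp only [map_add, map_sum, map_smul, smul_eq_mul] at this
      linarith
    have hle := sum_mul_le_sum_greedyFilling_mul (t := fun k => |π (z (σ k))|) ht hv
      (τ := y - (π c - T)) (by linarith [hy.1]) (s := fun k => s (σ k) * π (z (σ k)))
      (fun k => by rw [abs_mul]; exact mul_le_of_le_one_left (abs_nonneg _) (hs _))
      (by rw [sum_greedyFilling (by linarith [hy.1]) (by rw [hTσ]; linarith [hy.2]), hTσ,
            Equiv.sum_comp σ fun i => s i * π (z i), hsz]; ring)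
    rw [Equiv.sum_comp σ fun i => s i * π (z i) * v i] at hle
    have hsplit : f (c + ∑ i, s i • z i) =
        f c + ∑ i, (if π (z i) = 0 then s i * f (z i) else 0) + ∑ i, s i * π (z i) * v i := by
      rw [add_assoc, ← Finset.sum_add_distrib]
      simp only [map_add, map_sum, map_smul, smul_eq_mul, hvdef]
      congr 1
      refine Finset.sum_congr rfl fun i _ => ?_
      split_ifs with h
      · simp [h]
      · field_simp
        ring
    rw [hsplit]
    refine add_le_add (add_le_add le_rfl (Finset.sum_le_sum fun i _ => ?_)) hle
    split_ifs
    · calc s i * f (z i) ≤ |s i * f (z i)| := le_abs_self _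
        _ = |s i| * |f (z i)| := abs_mul _ _
        _ ≤ |f (z i)| := mul_le_of_le_one_left (abs_nonneg _) (hs i)
    · exact le_rfl
  · simp only [happ]
    rw [integral_Icc_eq_integral_Ioc, ← intervalIntegral.integral_of_le (by linarith)]
    have hsub := intervalIntegral.integral_comp_sub_right (a := π c - T) (b := π c + T)
      (fun τ => f c + ∑ i, (if π (z i) = 0 then |f (z i)| else 0) +
        ∑ k, greedyFilling (fun k => |π (z (σ k))|) τ k * v (σ k)) (π c - T)
    rw [hsub, sub_self, show π c + T - (π c - T) = 2 * T by ring]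
    have hi : ∀ k, IntervalIntegrable
        (fun τ => greedyFilling (fun k => |π (z (σ k))|) τ k * v (σ k)) volume 0 (2 * T) :=
      fun k => ((continuous_greedyFilling k).mul continuous_const).intervalIntegrable _ _
    have hsumi : IntervalIntegrable
        (fun τ => ∑ k, greedyFilling (fun k => |π (z (σ k))|) τ k * v (σ k)) volume 0 (2 * T) :=
      (continuous_finsetSum _ fun k _ =>
        (continuous_greedyFilling k).mul continuous_const).intervalIntegrable _ _
    rw [intervalIntegral.integral_add intervalIntegrable_const
        hsumi,
      intervalIntegral.integral_const, intervalIntegral.integral_finsetSum fun k _ => hi k]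
    simp only [intervalIntegral.integral_mul_const]
    have hint := sum_integral_greedyFilling_mul (t := fun k => |π (z (σ k))|) ht hv
    rw [hTσ] at hint
    -- The double sum runs over all ordered pairs, so the sorting permutation drops out.
    rw [hint, Equiv.sum_comp σ fun i => ∑ j, |π (z i)| * |π (z (σ j))| * |v i - v (σ j)|,
      Finset.sum_congr rfl fun i _ => Equiv.sum_comp σ fun j => |π (z i)| * |π (z j)| * |v i - v j|]
    have hinl : ∀ i, |f (if π (z i) = 0 then z i else 0)| =
        if π (z i) = 0 then |f (z i)| else 0 := fun i => by split_ifs <;> simp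
    have hinr : ∀ i j, |f ((|π (z i)| * |π (z j)| / (2 * T)) •
        ((1 / π (z i)) • z i - (1 / π (z j)) • z j))| =
        (2 * T)⁻¹ * (|π (z i)| * |π (z j)| * |v i - v j|) := fun i j => by
      rw [map_smul, map_sub, smul_eq_mul, abs_mul, abs_of_nonneg (by positivity)]
      ring
    simp only [monotonePathGenerators, Fintype.sum_sum_type, Sum.elim_inl, Sum.elim_inr,
      Fintype.sum_prod_type, ← hTdef, hinl, hinr, ← Finset.mul_sum, smul_eq_mul]
    field_simp
    ring

end Section

/-- The monotone path polytope of a zonotope is a zonotope. -/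
theorem monotonePathPolytope_zonotope {E : Type*} [NormedAddCommGroup E] [NormedSpace ℝ E]
    [FiniteDimensional ℝ E] {m : ℕ} (c : E) (z : Fin m → E) (π : E →ₗ[ℝ] ℝ) :
    monotonePathPolytope (zonotope c z) π = zonotope c (monotonePathGenerators z π) := by
  have : CompleteSpace E := FiniteDimensional.complete ℝ E
  have hQ := image_zonotope_eq_Icc c z π
  rcases (Finset.sum_nonneg fun i (_ : i ∈ Finset.univ) => abs_nonneg (π (z i))).eq_or_lt with
    hT | hT
  -- Here `π` is constant on the zonotope: the path polytope is the zonotope itself, and the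
  -- difference generators vanish.
  · have hz : ∀ i, π (z i) = 0 := fun i =>
      abs_eq_zero.1 ((Finset.sum_eq_zero_iff_of_nonneg fun i _ => abs_nonneg _).1 hT.symm i
        (Finset.mem_univ i))
    rw [← hT, sub_zero, add_zero, Set.Icc_self] at hQ
    rw [monotonePathPolytope_of_image_eq_singleton hQ]
    refine zonotope_eq_of_support_eq fun f => ?_
    simp [monotonePathGenerators, hz]
  have hlen : π c + ∑ i, |π (z i)| - (π c - ∑ i, |π (z i)|) = 2 * ∑ i, |π (z i)| := by ring
  rw [monotonePathPolytope_of_image_eq_Icc (by linarith) hQ, hlen]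
  have hint : ∀ ε σ, IntegrableOn (greedySection c z π ε σ)
      (Set.Icc (π c - ∑ i, |π (z i)|) (π c + ∑ i, |π (z i)|)) := fun ε σ =>
    (continuous_greedySection c z π ε σ).integrableOn_Icc
  set Q := Set.Icc (π c - ∑ i, |π (z i)|) (π c + ∑ i, |π (z i)|) with hQdef
  set L := 2 * ∑ i, |π (z i)| with hL
  have hLinv : 0 ≤ L⁻¹ := by positivity
  -- Only finitely many greedy sections occur, so the hull of their mean values is closed and can be
  -- separated from a point outside it.
  set p : (Fin m → SignType) × Equiv.Perm (Fin m) → E :=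
    fun q => L⁻¹ • ∫ y in Q, greedySection c z π q.1 q.2 y with hp
  have hfp : ∀ (f : E →L[ℝ] ℝ) q, f (p q) = L⁻¹ * ∫ y in Q, f (greedySection c z π q.1 q.2 y) :=
    fun f q => by
      rw [hp, map_smul, smul_eq_mul, f.integral_comp_comm (hint q.1 q.2)]
  apply Set.Subset.antisymm
  · rintro _ ⟨_, ⟨γ, hγ, hγmem, rfl⟩, rfl⟩
    refine mem_zonotope_iff_forall_le.2 fun f => ?_
    obtain ⟨ε, σ, hmax, hval⟩ := exists_greedySection_maximal (c := c) hT f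
    rw [← hval]
    simp only [map_smul, smul_eq_mul]
    rw [← f.integral_comp_comm hγ]
    exact mul_le_mul_of_nonneg_left (setIntegral_mono_on (f.integrable_comp hγ)
      (f.integrable_comp (hint ε σ)) measurableSet_Icc fun y hy => hmax y _ (hγmem y hy)) hLinv
  · have hconv : Convex ℝ (L⁻¹ • minkowskiIntegral volume Q
        (fun y => zonotope c z ∩ π ⁻¹' {y})) :=
      (convex_minkowskiIntegral _ fun y _ => (convex_zonotope c z).inter
        ((convex_singleton y).linear_preimage π)).smul _
    -- Each functional attains the support value of the target zonotope at some `p q`, so no point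
    -- of that zonotope can be separated from the hull.
    refine Set.Subset.trans ?_ (convexHull_min (s := Set.range p) ?_ hconv)
    · intro x hx
      by_contra hxp
      obtain ⟨f, u, hu, hfx⟩ := geometric_hahn_banach_closed_point
        (convex_convexHull ℝ (Set.range p)) ((Set.finite_range p).isClosed_convexHull ℝ) hxp
      obtain ⟨ε, σ, -, hval⟩ := exists_greedySection_maximal (c := c) hT f
      have h1 := hu _ (subset_convexHull ℝ _ ⟨(ε, σ), rfl⟩)
      have h2 := mem_zonotope_iff_forall_le.1 hx f
      rw [← hval, ← hfp f (ε, σ)] at h2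
      linarith
    · rintro _ ⟨q, rfl⟩
      exact ⟨_, ⟨_, hint q.1 q.2, fun y hy => greedySection_mem c z π q.1 q.2 hy, rfl⟩, rfl⟩

/-! ### Comparison with the sweep polytope -/

/-- The positive factors that turn the second family of generators of the monotone path polytope
into generators of the sweep polytope. -/
noncomputable def sweepScale {E ι : Type*} [AddCommGroup E] [Module ℝ E] [Fintype ι]
    (z : ι → E) (π : E →ₗ[ℝ] ℝ) (p : ι × ι) : ℝ :=
  -- The product with the coefficient in `monotonePathGenerators` is `1 / 4`. In the other case that
  -- coefficient is zero, and any positive value would do.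
  if π (z p.1) ≠ 0 ∧ π (z p.2) ≠ 0 then
    (∑ i, |π (z i)|) / (2 * (|π (z p.1)| * |π (z p.2)|)) else 1

lemma sum_abs_pos {ι : Type*} [Fintype ι] {t : ι → ℝ} {i : ι} (h : t i ≠ 0) : 0 < ∑ j, |t j| :=
  Finset.sum_pos' (fun _ _ => abs_nonneg _) ⟨i, Finset.mem_univ i, abs_pos.2 h⟩

lemma sweepScale_pos {E ι : Type*} [AddCommGroup E] [Module ℝ E] [Fintype ι]
    (z : ι → E) (π : E →ₗ[ℝ] ℝ) (p : ι × ι) : 0 < sweepScale z π p := by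
  unfold sweepScale
  split_ifs with h
  · have h1 := abs_pos.2 h.1
    have h2 := abs_pos.2 h.2
    have h3 := sum_abs_pos (t := fun i => π (z i)) h.1
    positivity
  · exact one_pos

lemma sum_subtype_eq_sum {ι M : Type*} [Fintype ι] [AddCommMonoid M] {p : ι → Prop}
    [Fintype {i // p i}] (F : ι → M) (h : ∀ i, ¬p i → F i = 0) :
    ∑ i : {i // p i}, F i = ∑ i, F i := by
  classical
  rw [← Fintype.sum_subtype_add_sum_subtype p F, Fintype.sum_eq_zero (fun i : {i // ¬p i} => F i)
    fun i => h i.1 i.2, add_zero]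
  congr!

/-- Pairs involving a kernel generator contribute zero, so the index set can be enlarged from the
subtype to all pairs, matching the path polytope's family. -/
lemma sweepPolytope_normalized_eq_zonotope {E : Type*} [NormedAddCommGroup E] [NormedSpace ℝ E]
    {m : ℕ} (z : Fin m → E) (π : E →ₗ[ℝ] ℝ) [Fintype {i : Fin m // π (z i) ≠ 0}] :
    sweepPolytope (fun i : {i : Fin m // π (z i) ≠ 0} => (1 / π (z i)) • z i) =
      zonotope 0 (fun p : Fin m × Fin m =>
        sweepScale z π p • monotonePathGenerators z π (Sum.inr p)) := by
  rw [sweepPolytope_eq_zonotope]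
  refine zonotope_eq_of_support_eq fun f => ?_
  congr 1
  set G : Fin m → Fin m → ℝ := fun i j =>
    |f (sweepScale z π (i, j) • monotonePathGenerators z π (Sum.inr (i, j)))| with hG
  have h1 : ∀ i, π (z i) = 0 → ∀ j, G i j = 0 := fun i h j => by
    simp [hG, monotonePathGenerators, h]
  have h2 : ∀ j, π (z j) = 0 → ∀ i, G i j = 0 := fun j h i => by
    simp [hG, monotonePathGenerators, h]
  have h3 : ∀ i j : {i : Fin m // π (z i) ≠ 0},
      |f ((1 / 4 : ℝ) • ((1 / π (z i)) • z i - (1 / π (z j)) • z j))| = G i j := fun i j => by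
    have hi := abs_ne_zero.2 i.2
    have hj := abs_ne_zero.2 j.2
    have hT := (sum_abs_pos (t := fun i => π (z i)) i.2).ne'
    simp only [hG, monotonePathGenerators, Sum.elim_inr, sweepScale, smul_smul]
    rw [if_pos ⟨i.2, j.2⟩]
    congr 3
    field_simp
    norm_num
  simp only [Fintype.sum_prod_type, h3]
  rw [← sum_subtype_eq_sum (p := fun i => π (z i) ≠ 0) (fun i => ∑ j, G i j)
    fun i hi => Finset.sum_eq_zero fun j _ => h1 i (not_not.1 hi) j]
  exact Finset.sum_congr rfl fun i _ => sum_subtype_eq_sum (p := fun i => π (z i) ≠ 0) (G i)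
    fun j hj => h2 j (not_not.1 hj) i

/-- The centre `c'` is free because the normal fan ignores translations; it absorbs the centre of
the minimal face. -/
lemma normallyEquivalent_monotonePathPolytope_zonotope {E : Type*} [NormedAddCommGroup E]
    [InnerProductSpace ℝ E] [FiniteDimensional ℝ E] {m : ℕ} (c c' : E) (z : Fin m → E)
    (π : E →ₗ[ℝ] ℝ) :
    NormallyEquivalent (monotonePathPolytope (zonotope c z) π)
      (zonotope c' fun k =>
        Sum.elim (fun _ => 1) (sweepScale z π) k • monotonePathGenerators z π k) := by
  rw [monotonePathPolytope_zonotope]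
  refine normallyEquivalent_zonotope c c' _ ?_
  rintro (i | p)
  exacts [one_pos, sweepScale_pos z π p]

lemma monotonePathPolytope_normallyEquivalent_minFace_add {E : Type*} [NormedAddCommGroup E]
    [InnerProductSpace ℝ E] [FiniteDimensional ℝ E] {m : ℕ} (c : E) (z : Fin m → E)
    (π : E →ₗ[ℝ] ℝ) [Fintype {i : Fin m // π (z i) ≠ 0}] :
    NormallyEquivalent (monotonePathPolytope (zonotope c z) π)
      (minFace (zonotope c z) π +
        sweepPolytope (fun i : {i : Fin m // π (z i) ≠ 0} => (1 / π (z i)) • z i)) := by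
  rw [sweepPolytope_normalized_eq_zonotope, minFace_zonotope, zonotope_add_zonotope]
  convert normallyEquivalent_monotonePathPolytope_zonotope c _ z π using 2
  ext (i | p) <;> simp [monotonePathGenerators]

lemma monotonePathPolytope_normallyEquivalent_sweepPolytope {E : Type*} [NormedAddCommGroup E]
    [InnerProductSpace ℝ E] [FiniteDimensional ℝ E] {m : ℕ} (c : E) (z : Fin m → E)
    (π : E →ₗ[ℝ] ℝ) [Fintype {i : Fin m // π (z i) ≠ 0}] (h : ∀ i, z i ≠ 0 → π (z i) ≠ 0) :
    NormallyEquivalent (monotonePathPolytope (zonotope c z) π)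
      (sweepPolytope (fun i : {i : Fin m // π (z i) ≠ 0} => (1 / π (z i)) • z i)) := by
  convert normallyEquivalent_monotonePathPolytope_zonotope c 0 z π using 1
  rw [sweepPolytope_normalized_eq_zonotope]
  refine zonotope_eq_of_support_eq fun f => ?_
  have h0 : ∀ i, (if π (z i) = 0 then z i else 0) = 0 := fun i => by
    split_ifs with hi
    · by_contra hz
      exact h i hz hi
    · rfl
  simp [monotonePathGenerators, h0]

/-! ### Homogenized configurations -/

/-- The monotone path polytope of a scaled zonotope over a homogenized point configuration. -/
lemma monotonePathPolytope_smul_homogenization {E : Type*} [NormedAddCommGroup E] [NormedSpace ℝ E]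
    [FiniteDimensional ℝ E] {n : ℕ} (a : Fin n → E) {r : ℝ} (hr : 0 ≤ r) (hrn : n ≠ 0 → r ≠ 0) :
    monotonePathPolytope (r • zonotope 0 (homogenization a)) (height E) =
      zonotope 0 fun p : Fin n × Fin n => (r / (2 * n)) • (a p.1 - a p.2, (0 : ℝ)) := by
  rw [smul_zonotope, smul_zero, monotonePathPolytope_zonotope]
  refine zonotope_eq_of_support_eq fun f => ?_
  congr 1
  rw [Fintype.sum_sum_type]
  have hh : ∀ i, height E (r • homogenization a i) = r := fun i => by
    simp [height, homogenization]
  have hn : ∀ _ : Fin n, (n : ℝ) ≠ 0 ∧ r ≠ 0 := fun i =>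
    have : n ≠ 0 := (Fin.pos i).ne'
    ⟨Nat.cast_ne_zero.2 this, hrn this⟩
  rw [Finset.sum_eq_zero, zero_add]
  · refine Finset.sum_congr rfl fun p _ => ?_
    obtain ⟨hn0, hr0⟩ := hn p.1
    congr 2
    -- All heights equal `r`, so the coefficient is `r * r / (2 * (n * r)) = r / (2 * n)`, and
    -- normalizing gives back the points `(a i, 1)`.
    simp only [monotonePathGenerators, Sum.elim_inr, hh, abs_of_nonneg hr, Finset.sum_const,
      Finset.card_univ, Fintype.card_fin, nsmul_eq_mul, smul_smul]
    rw [one_div_mul_cancel hr0, one_smul, one_smul]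
    congr 1
    · field_simp
    · simp [homogenization]
  · intro i _
    simp [monotonePathGenerators, hh, (hn i).2]

lemma monotonePathPolytope_homogenization_eq_prod {E : Type*} [NormedAddCommGroup E]
    [NormedSpace ℝ E] [FiniteDimensional ℝ E] {n : ℕ} (a : Fin n → E) :
    monotonePathPolytope (((n : ℝ) / 2) • zonotope 0 (homogenization a)) (height E) =
      sweepPolytope a ×ˢ ({0} : Set ℝ) := by
  rw [monotonePathPolytope_smul_homogenization a (by positivity) (fun h => by positivity),
    sweepPolytope_eq_zonotope, prod_singleton_zero_zonotope]
  congr 1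
  ext1 p
  have hn : (n : ℝ) ≠ 0 := Nat.cast_ne_zero.2 (Fin.pos p.1).ne'
  -- The dilation `n / 2` is exactly what produces the factor `1 / 4` of the sweep polytope over
  -- ordered pairs.
  rw [show (n : ℝ) / 2 / (2 * n) = 1 / 4 by field_simp; norm_num]
  simp

lemma affinelyIsomorphic_sweepPolytope_monotonePathPolytope {E : Type*} [NormedAddCommGroup E]
    [NormedSpace ℝ E] [FiniteDimensional ℝ E] {n : ℕ} (a : Fin n → E) :
    AffinelyIsomorphic (sweepPolytope a)
      (monotonePathPolytope (zonotope 0 (homogenization a)) (height E)) := by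
  have h := monotonePathPolytope_smul_homogenization a zero_le_one fun _ => one_ne_zero
  rw [one_smul] at h
  rw [h, sweepPolytope_eq_zonotope]
  -- The factor `2 / n` turns `1 / 4` into `1 / (2 * n)`. For `n = 0` any nonzero value keeps the
  -- map injective.
  obtain ⟨r, hr, hrn⟩ : ∃ r : ℝ, r ≠ 0 ∧ (n ≠ 0 → r = 2 / n) := by
    rcases eq_or_ne n 0 with hn | hn
    · exact ⟨1, one_ne_zero, fun h => absurd hn h⟩
    · exact ⟨2 / n, by positivity, fun _ => rfl⟩
  set f : E →ₗ[ℝ] E × ℝ := r • LinearMap.inl ℝ E ℝ with hf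
  have hinj : Function.Injective f := fun x y hxy => by
    simpa [hf, hr] using hxy
  refine ⟨f.toAffineMap, ?_⟩
  have himg := image_zonotope f 0 fun p : Fin n × Fin n => (1 / 4 : ℝ) • (a p.1 - a p.2)
  have hgen : (fun p : Fin n × Fin n => f ((1 / 4 : ℝ) • (a p.1 - a p.2))) =
      fun p : Fin n × Fin n => ((1 : ℝ) / (2 * n)) • (a p.1 - a p.2, (0 : ℝ)) := by
    ext1 p
    have hn : n ≠ 0 := (Fin.pos p.1).ne'
    have hn' : (n : ℝ) ≠ 0 := Nat.cast_ne_zero.2 hn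
    rw [map_smul, hf, LinearMap.smul_apply, smul_smul, hrn hn, LinearMap.inl_apply]
    congr 1
    field_simp
    norm_num
  rw [map_zero, hgen] at himg
  rw [← himg]
  exact hinj.injOn.bijOn_image

theorem mainTheorem12 (d : ℕ) :
    (∀ (m : ℕ) (c : EuclideanSpace ℝ (Fin d)) (z : Fin m → EuclideanSpace ℝ (Fin d))
        (π : EuclideanSpace ℝ (Fin d) →ₗ[ℝ] ℝ),
      NormallyEquivalent
        (monotonePathPolytope (zonotope c z) π)
        (minFace (zonotope c z) π +
          sweepPolytope (fun i : {i : Fin m // π (z i) ≠ 0} => (1 / π (z i)) • z i))) ∧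
    (∀ (m : ℕ) (c : EuclideanSpace ℝ (Fin d)) (z : Fin m → EuclideanSpace ℝ (Fin d))
        (π : EuclideanSpace ℝ (Fin d) →ₗ[ℝ] ℝ),
      (∀ i, z i ≠ 0 → π (z i) ≠ 0) →
      NormallyEquivalent
        (monotonePathPolytope (zonotope c z) π)
        (sweepPolytope (fun i : {i : Fin m // π (z i) ≠ 0} => (1 / π (z i)) • z i))) ∧
    (∀ (n : ℕ) (a : Fin n → EuclideanSpace ℝ (Fin d)),
      monotonePathPolytope (((n : ℝ) / 2) • zonotope 0 (homogenization a))
          (height (EuclideanSpace ℝ (Fin d))) =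
        sweepPolytope a ×ˢ ({0} : Set ℝ) ∧
      AffinelyIsomorphic (sweepPolytope a)
        (monotonePathPolytope (zonotope 0 (homogenization a))
          (height (EuclideanSpace ℝ (Fin d))))) := by
  exact ⟨fun _ c z π => monotonePathPolytope_normallyEquivalent_minFace_add c z π,
    fun _ c z π h => monotonePathPolytope_normallyEquivalent_sweepPolytope c z π h,
    fun _ a => ⟨monotonePathPolytope_homogenization_eq_prod a,
      affinelyIsomorphic_sweepPolytope_monotonePathPolytope a⟩⟩
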